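/- Let $d$ be a natural number and let $W=(W_t)_{t\ge 0}$ be a standard Brownian motion in $\mathbb{R}^d$ started at $0$, so that $p+W$ is Brownian motion started at $p$. A set $A\subseteq\mathbb{R}^d$ is called \emph{avoidable from} $p\in\mathbb{R}^d$ if the probability that $p+W_t\in A$ for some $t\ge 0$ is smaller than one; and $A$ is called \emph{avoidable} if $\mathbb{R}^d\setminus A$ is connected and $A$ is avoidable from some point. Let $A$ and $B$ be closed avoidable subsets of $\mathbb{R}^d$ such that $\mathbb{R}^d\setminus(A\cup B)$ is (non-empty and) connected. Then $A\cup B$ is avoidable; moreover, it is avoidable from every point $p\in\mathbb{R}^d\setminus(A\cup B)$. -/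

import Mathlib

open MeasureTheory ProbabilityTheory
open scoped NNReal

/-- `W` is a standard `d`-dimensional Brownian motion started at the origin: its coordinates are
independent one-dimensional standard Brownian motions. -/
structure IsBrownianMotion {d : ℕ} {Ω : Type*} [MeasurableSpace Ω]
    (W : ℝ≥0 → Ω → EuclideanSpace ℝ (Fin d)) (P : Measure Ω) : Prop where
  /-- The underlying measure is a probability measure (this is a consequence of the other fields
  unless `d = 0`). -/
  isProbabilityMeasure : IsProbabilityMeasure P
  /-- Each coordinate is a real Brownian motion (with almost surely continuous paths). -/
  coord : ∀ i : Fin d, IsBrownianReal (fun t ω ↦ W t ω i) P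
  /-- The coordinate processes are independent. -/
  indep : iIndepFun (fun (i : Fin d) (ω : Ω) (t : ℝ≥0) ↦ W t ω i) P

/-- The event that the Brownian motion `p + W` started at `p` hits the set `A`. -/
def hitEvent {d : ℕ} {Ω : Type*} (W : ℝ≥0 → Ω → EuclideanSpace ℝ (Fin d))
    (A : Set (EuclideanSpace ℝ (Fin d))) (p : EuclideanSpace ℝ (Fin d)) : Set Ω :=
  {ω | ∃ t : ℝ≥0, p + W t ω ∈ A}

/-- `A` is avoidable from `p`: Brownian motion started at `p` has a probability smaller than one
of hitting `A`. When `W` is a Brownian motion this depends on `A` and `p` only, because the law of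
`W` is unique. -/
def AvoidableFrom {d : ℕ} {Ω : Type*} [MeasurableSpace Ω]
    (W : ℝ≥0 → Ω → EuclideanSpace ℝ (Fin d)) (P : Measure Ω)
    (A : Set (EuclideanSpace ℝ (Fin d))) (p : EuclideanSpace ℝ (Fin d)) : Prop :=
  P (hitEvent W A p) < 1

/-- `A` is avoidable: its complement is connected and `A` is avoidable from some point. -/
def IsAvoidable {d : ℕ} {Ω : Type*} [MeasurableSpace Ω]
    (W : ℝ≥0 → Ω → EuclideanSpace ℝ (Fin d)) (P : Measure Ω)
    (A : Set (EuclideanSpace ℝ (Fin d))) : Prop :=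
  IsConnected Aᶜ ∧ ∃ p, AvoidableFrom W P A p

/-! Write $v_C(x)$ (`avoidProb`) for the probability that Brownian motion from $x$ never meets $C$.
The crux is `tendsto_lintegral_avoidProb`: if $v_C(p)>0$ for a single $p$, then $E\,v_C(x+W_n)\to 1$
for every $x$. This expectation is the probability of no visit from time $n$ on, so it increases to
a limit $c$, and $c$ is independent of $x$ because Gaussian laws of large variance with different
centres merge. Also $v_C\le c$, so the Markov property gives $v_C(p)\le c\,P(\text{no visit up to }
n)\to c\,v_C(p)$, whence $c=1$. Since $v_A+v_B\le 1+v_{A\cup B}$, averaging over $W_n$ turns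
$v_{A\cup B}\equiv 0$ into $2\le 1$; so $A\cup B$ is avoidable from some point
(`exists_avoidProb_union_ne_zero`). To reach all points, `avoidProb_eq_zero_of_dist_lt` shows that
zeros of $v_C$ off $C$ spread to a neighbourhood: over a short time the Brownian bridge stays small
with positive probability, independently of the endpoint, so $v_C(y)=0$ forces $v_C=0$ almost
everywhere near $y$, and a short Gaussian averaging removes the "almost". Thus $\{v_C=0\}$ and
$\{v_C>0\}$ are both open in the complement, and connectedness decides (`avoidProb_ne_zero`). Only
fixed-time Markov properties are used, neither stopping times nor harmonic functions. -/

section BrownianMotion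

open Filter Topology

variable {d : ℕ} {Ω : Type*} [MeasurableSpace Ω] {P : Measure Ω}
  {W V : ℝ≥0 → Ω → EuclideanSpace ℝ (Fin d)}

/-! ### Brownian motion: regular versions, uniqueness in law, Markov property, bridge. -/

namespace IsBrownianMotion

lemma congr (hW : IsBrownianMotion W P) (h : ∀ᵐ ω ∂P, ∀ t, W t ω = V t ω) :
    IsBrownianMotion V P where
  isProbabilityMeasure := hW.isProbabilityMeasure
  coord i :=
    { toIsPreBrownianReal := (hW.coord i).toIsPreBrownianReal.congr fun t ↦ by
        filter_upwards [h] with ω hω using by rw [hω t]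
      cont := by
        filter_upwards [(hW.coord i).cont, h] with ω h1 h2
        simpa only [h2] using h1 }
  indep := hW.indep.congr fun i ↦ by
    filter_upwards [h] with ω hω
    funext t
    rw [hω t]

lemma aemeasurable (hW : IsBrownianMotion W P) (t : ℝ≥0) : AEMeasurable (W t) P := by
  have h : AEMeasurable (fun ω ↦ (fun i ↦ W t ω i : Fin d → ℝ)) P :=
    aemeasurable_pi_lambda _ fun i ↦ (hW.coord i).toIsPreBrownianReal.aemeasurable t
  exact (WithLp.measurable_toLp 2 (Fin d → ℝ)).comp_aemeasurable h

lemma ae_continuous (hW : IsBrownianMotion W P) : ∀ᵐ ω ∂P, Continuous (W · ω) := by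
  have h : ∀ᵐ ω ∂P, ∀ i, Continuous (fun t ↦ W t ω i) := ae_all_iff.2 fun i ↦ (hW.coord i).cont
  filter_upwards [h] with ω hω
  exact (PiLp.continuous_toLp 2 (fun _ : Fin d ↦ ℝ)).comp (continuous_pi hω)

lemma ae_zero (hW : IsBrownianMotion W P) : ∀ᵐ ω ∂P, W 0 ω = 0 := by
  have h : ∀ᵐ ω ∂P, ∀ i, W 0 ω i = 0 :=
    ae_all_iff.2 fun i ↦ (hW.coord i).toIsPreBrownianReal.eval_zero_ae_eq_zero
  filter_upwards [h] with ω hω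
  ext i
  simpa using hω i

/-- A Brownian motion is indistinguishable from one that is measurable at all times, starts at `0`
and has continuous paths. -/
lemma exists_measurable_continuous (hW : IsBrownianMotion W P) :
    ∃ V : ℝ≥0 → Ω → EuclideanSpace ℝ (Fin d), (∀ t, Measurable (V t)) ∧
      (∀ ω, Continuous (V · ω)) ∧ (∀ ω, V 0 ω = 0) ∧ ∀ᵐ ω ∂P, ∀ t, W t ω = V t ω := by
  classical
  let D := TopologicalSpace.denseSeq ℝ≥0
  have hgood : ∀ᵐ ω ∂P, Continuous (W · ω) ∧ W 0 ω = 0 ∧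
      ∀ n, W (D n) ω = (hW.aemeasurable (D n)).mk _ ω :=
    hW.ae_continuous.and (hW.ae_zero.and (ae_all_iff.2 fun n ↦ (hW.aemeasurable (D n)).ae_eq_mk))
  obtain ⟨G, hGae, hG, hGsub⟩ := hgood.exists_measurable_mem
  -- On the good set, path continuity makes the value at `t` a limit of measurable versions at dense
  -- times.
  have key (t : ℝ≥0) : Measurable (fun ω ↦ if ω ∈ G then W t ω else 0) := by
    have hcl : t ∈ closure (Set.range D) := TopologicalSpace.denseRange_denseSeq ℝ≥0 t
    obtain ⟨x, hx, hxt⟩ := mem_closure_iff_seq_limit.1 hcl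
    choose k hk using hx
    refine measurable_of_tendsto_metrizable
      (f := fun n ω ↦ if ω ∈ G then (hW.aemeasurable (D (k n))).mk _ ω else 0) (fun n ↦
      Measurable.ite hG (hW.aemeasurable (D (k n))).measurable_mk measurable_const) ?_
    rw [tendsto_pi_nhds]
    intro ω
    by_cases hω : ω ∈ G
    · simp only [hω, if_true]
      have h1 := (hGsub ω hω).1.tendsto t |>.comp hxt
      refine h1.congr fun n ↦ ?_
      rw [← (hGsub ω hω).2.2 (k n), Function.comp_apply, hk]
    · simp [hω]
  refine ⟨fun t ω ↦ if ω ∈ G then W t ω else 0, key, fun ω ↦ ?_, fun ω ↦ ?_, ?_⟩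
  · by_cases hω : ω ∈ G
    · simpa [hω] using (hGsub ω hω).1
    · simpa [hω] using continuous_const
  · by_cases hω : ω ∈ G
    · simpa [hω] using (hGsub ω hω).2.1
    · simp [hω]
  · filter_upwards [hGae] with ω hω t
    simp [hω]

/-- The coordinates of a Brownian motion are jointly Gaussian. -/
lemma isGaussianProcess (hW : IsBrownianMotion W P) :
    IsGaussianProcess (fun (p : Fin d × ℝ≥0) ω ↦ W p.2 ω p.1) P where
  hasGaussianLaw I := by
    classical
    -- Enlarging `I` to the grid of all coordinates times `J` lets independence of the coordinates
    -- give joint Gaussianity.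
    let J := I.image Prod.snd
    have h1 : ∀ i : Fin d, HasGaussianLaw (fun ω ↦ J.restrict (fun t ↦ W t ω i)) P := fun i ↦
      (IsPreBrownianReal.isGaussianProcess (hW.coord i).toIsPreBrownianReal).hasGaussianLaw J
    have h2 : iIndepFun (fun (i : Fin d) ω ↦ J.restrict (fun t ↦ W t ω i)) P :=
      hW.indep.comp (fun _ ↦ J.restrict) fun _ ↦ Finset.measurable_restrict _
    have h3 := h2.hasGaussianLaw h1
    let L : (Fin d → J → ℝ) →L[ℝ] (I → ℝ) :=
      { toFun x p := x p.1.1 ⟨p.1.2, Finset.mem_image_of_mem _ p.2⟩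
        map_add' x y := by ext; simp
        map_smul' c x := by ext; simp }
    exact h3.map L

lemma covariance_self_coord (hW : IsBrownianMotion W P) (i : Fin d) (s t : ℝ≥0) :
    cov[fun ω ↦ W s ω i, fun ω ↦ W t ω i; P] = min s t :=
  (hW.coord i).toIsPreBrownianReal.covariance_eval s t

lemma memLp_coord (hW : IsBrownianMotion W P) (i : Fin d) (t : ℝ≥0) :
    MemLp (fun ω ↦ W t ω i) 2 P :=
  ((hW.coord i).toIsPreBrownianReal.hasLaw_eval t).hasGaussianLaw.memLp_two

lemma covariance_coord (hW : IsBrownianMotion W P) (i j : Fin d) (s t : ℝ≥0) :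
    cov[fun ω ↦ W s ω i, fun ω ↦ W t ω j; P] = if i = j then (min s t : ℝ) else 0 := by
  have := hW.isProbabilityMeasure
  split_ifs with h
  · subst h
    simpa using hW.covariance_self_coord i s t
  · have h1 := (hW.indep.indepFun h).comp (measurable_pi_apply s) (measurable_pi_apply t)
    exact h1.covariance_eq_zero (hW.memLp_coord i s) (hW.memLp_coord j t)

lemma shift (hW : IsBrownianMotion W P) (s : ℝ≥0) :
    IsBrownianMotion (fun t ω ↦ W (s + t) ω - W s ω) P where
  isProbabilityMeasure := hW.isProbabilityMeasure
  coord i := (hW.coord i).shift s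
  indep := hW.indep.comp (fun _ f t ↦ f (s + t) - f s) fun _ ↦ by fun_prop

/-- All Brownian motions on a probability space have the same law. -/
lemma map_eq (hW : IsBrownianMotion W P) (hV : IsBrownianMotion V P)
    (mW : ∀ t, Measurable (W t)) (mV : ∀ t, Measurable (V t)) :
    P.map (fun ω t ↦ W t ω) = P.map (fun ω t ↦ V t ω) := by
  have := hW.isProbabilityMeasure
  have mW' (i : Fin d) : Measurable fun ω t ↦ W t ω i := by fun_prop
  have mV' (i : Fin d) : Measurable fun ω t ↦ V t ω i := by fun_prop
  have h1 := (iIndepFun_iff_map_fun_eq_pi_map fun i ↦ (mW' i).aemeasurable).1 hW.indep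
  have h2 := (iIndepFun_iff_map_fun_eq_pi_map fun i ↦ (mV' i).aemeasurable).1 hV.indep
  have h3 (i : Fin d) : P.map (fun ω t ↦ W t ω i) = P.map (fun ω t ↦ V t ω i) := by
    rw [map_eq_iff_forall_finset_map_restrict_eq (mW' i).aemeasurable (mV' i).aemeasurable]
    intro I
    rw [((hW.coord i).toIsPreBrownianReal.hasLaw I).map_eq,
      ((hV.coord i).toIsPreBrownianReal.hasLaw I).map_eq]
  have h4 : P.map (fun ω i t ↦ W t ω i) = P.map (fun ω i t ↦ V t ω i) := by
    rw [h1, h2]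
    simp_rw [h3]
  let Φ : (Fin d → ℝ≥0 → ℝ) → ℝ≥0 → EuclideanSpace ℝ (Fin d) :=
    fun x t ↦ WithLp.toLp 2 fun i ↦ x i t
  have hΦ : Measurable Φ := measurable_pi_lambda _ fun t ↦
    (WithLp.measurable_toLp 2 (Fin d → ℝ)).comp (by fun_prop)
  have h5 := congrArg (Measure.map Φ) h4
  rwa [Measure.map_map hΦ (by fun_prop), Measure.map_map hΦ (by fun_prop)] at h5

/-- The Markov property. -/
lemma indepFun_shift (hW : IsBrownianMotion W P) (s : ℝ≥0) :
    IndepFun (fun ω (t : Set.Iic s) ↦ W t ω) (fun ω t ↦ W (s + t) ω - W s ω) P := by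
  have := hW.isProbabilityMeasure
  have hg := hW.isGaussianProcess
  have hi := IsGaussianProcess.indepFun_of_covariance_eq_zero (P := P)
    (X := fun (p : Fin d × Set.Iic s) ω ↦ W p.2 ω p.1)
    (Y := fun (p : Fin d × ℝ≥0) ω ↦ W (s + p.2) ω p.1 - W s ω p.1) ?_ ?_ ?_ ?_
  · let Φ (S : Type) (x : Fin d × S → ℝ) (t : S) : EuclideanSpace ℝ (Fin d) :=
      WithLp.toLp 2 fun i ↦ x (i, t)
    have hΦ (S : Type) : Measurable (Φ S) := measurable_pi_lambda _ fun t ↦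
      (WithLp.measurable_toLp 2 (Fin d → ℝ)).comp (by fun_prop)
    exact hi.comp (hΦ _) (hΦ _)
  · classical
    refine hg.of_isGaussianProcess ?_
    rintro (⟨i, t, ht⟩ | ⟨i, t⟩)
    · exact ⟨{(i, t)},
        { toFun x := x ⟨(i, t), by simp⟩
          map_add' x y := by simp
          map_smul' c x := by simp }, by simp⟩
    · exact ⟨{(i, s), (i, s + t)},
        { toFun x := x ⟨(i, s + t), by simp⟩ - x ⟨(i, s), by simp⟩
          map_add' x y := by simp; abel
          map_smul' c x := by simp; ring }, by simp⟩
  · exact fun p ↦ hg.aemeasurable (p.1, p.2.1)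
  · exact fun p ↦ (hg.aemeasurable (p.1, s + p.2)).sub (hg.aemeasurable (p.1, s))
  · rintro ⟨i, t, ht⟩ ⟨j, r⟩
    rw [covariance_fun_sub_right (hW.memLp_coord _ _) (hW.memLp_coord _ _) (hW.memLp_coord _ _),
      hW.covariance_coord, hW.covariance_coord]
    have h1 : t ≤ s := ht
    have h2 : t ≤ s + r := h1.trans le_self_add
    -- Both covariances equal `t`, because `t ≤ s ≤ s + r`.
    rw [← NNReal.coe_min, ← NNReal.coe_min, min_eq_left h1, min_eq_left h2, sub_self]

/-- The Brownian bridge on `[0, s]` is independent of the value at time `s`. -/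
lemma indepFun_bridge (hW : IsBrownianMotion W P) (s : ℝ≥0) (hs : s ≠ 0) :
    IndepFun (fun ω (t : Set.Iic s) ↦ W t ω - ((t : ℝ) / (s : ℝ)) • W s ω) (W s) P := by
  have := hW.isProbabilityMeasure
  have hg := hW.isGaussianProcess
  have hi := IsGaussianProcess.indepFun_of_covariance_eq_zero (P := P)
    (X := fun (p : Fin d × Set.Iic s) ω ↦ W p.2 ω p.1 - ((p.2 : ℝ) / (s : ℝ)) * W s ω p.1)
    (Y := fun (j : Fin d) ω ↦ W s ω j) ?_ ?_ ?_ ?_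
  · let Φ (x : Fin d × Set.Iic s → ℝ) (t : Set.Iic s) : EuclideanSpace ℝ (Fin d) :=
      WithLp.toLp 2 fun i ↦ x (i, t)
    have hΦ : Measurable Φ := measurable_pi_lambda _ fun t ↦
      (WithLp.measurable_toLp 2 (Fin d → ℝ)).comp (by fun_prop)
    exact hi.comp hΦ (WithLp.measurable_toLp 2 (Fin d → ℝ))
  · classical
    refine hg.of_isGaussianProcess ?_
    rintro (⟨i, t, ht⟩ | i)
    · exact ⟨{(i, s), (i, t)},
        { toFun x := x ⟨(i, t), by simp⟩ - ((t : ℝ) / (s : ℝ)) * x ⟨(i, s), by simp⟩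
          map_add' x y := by simp; ring
          map_smul' c x := by simp; ring }, by simp⟩
    · exact ⟨{(i, s)},
        { toFun x := x ⟨(i, s), by simp⟩
          map_add' x y := by simp
          map_smul' c x := by simp }, by simp⟩
  · exact fun p ↦ (hg.aemeasurable (p.1, p.2.1)).sub ((hg.aemeasurable (p.1, s)).const_mul _)
  · exact fun j ↦ hg.aemeasurable (j, s)
  · rintro ⟨i, t, ht⟩ j
    rw [covariance_fun_sub_left (hW.memLp_coord _ _) ((hW.memLp_coord _ _).const_mul _)
      (hW.memLp_coord _ _), covariance_const_mul_left, hW.covariance_coord, hW.covariance_coord]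
    have h1 : (t : ℝ) ≤ s := NNReal.coe_le_coe.2 ht
    have h2 : (s : ℝ) ≠ 0 := by simpa using hs
    -- The covariance with the endpoint is $t-(t/s)\,s=0$.
    rw [min_eq_left h1, min_self]
    split_ifs
    · field_simp
      ring
    · simp

end IsBrownianMotion

end BrownianMotion

/-! ### Gaussian densities and the merging of Brownian laws at large times. -/

section HeatKernel

open Filter Topology

variable {d : ℕ}

/-- The density of the centred Gaussian distribution with covariance `t • 1`. -/
noncomputable def heatKernel (t : ℝ) (x : EuclideanSpace ℝ (Fin d)) : ℝ :=
  ((2 * Real.pi * t) ^ ((d : ℝ) / 2))⁻¹ * Real.exp (-(1 / (2 * t)) * ‖x‖ ^ 2)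

lemma heatKernel_pos {t : ℝ} (ht : 0 < t) (x : EuclideanSpace ℝ (Fin d)) :
    0 < heatKernel t x := by
  unfold heatKernel
  have := Real.pi_pos
  positivity

lemma measurable_heatKernel (t : ℝ) :
    Measurable (heatKernel t : EuclideanSpace ℝ (Fin d) → ℝ) := by
  unfold heatKernel
  fun_prop

lemma integral_heatKernel_mul_cexp {t : ℝ} (ht : 0 < t) (w : EuclideanSpace ℝ (Fin d)) :
    ∫ x, (heatKernel t x : ℂ) * Complex.exp (inner ℝ x w * Complex.I) =
      Complex.exp (-(t * ‖w‖ ^ 2 / 2)) := by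
  have hb : 0 < ((1 / (2 * t) : ℝ) : ℂ).re := by
    rw [Complex.ofReal_re]; positivity
  have h := GaussianFourier.integral_cexp_neg_mul_sq_norm_add hb Complex.I w
  have h1 : ∀ x : EuclideanSpace ℝ (Fin d),
      (heatKernel t x : ℂ) * Complex.exp (inner ℝ x w * Complex.I) =
      (((2 * Real.pi * t) ^ ((d : ℝ) / 2))⁻¹ : ℝ) *
        Complex.exp (-((1 / (2 * t) : ℝ) : ℂ) * ‖x‖ ^ 2 + Complex.I * inner ℝ w x) := by
    intro x
    rw [heatKernel, Complex.exp_add, real_inner_comm]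
    push_cast
    ring_nf
  simp_rw [h1]
  rw [integral_const_mul, h, ← mul_assoc]
  have h2 : ((Real.pi : ℂ) / ((1 / (2 * t) : ℝ) : ℂ)) ^
      ((Module.finrank ℝ (EuclideanSpace ℝ (Fin d)) : ℂ) / 2) =
      (((2 * Real.pi * t) ^ ((d : ℝ) / 2) : ℝ) : ℂ) := by
    rw [Complex.ofReal_cpow (by have := Real.pi_pos; positivity)]
    rw [finrank_euclideanSpace_fin]
    push_cast
    congr 1
    have : (t : ℂ) ≠ 0 := by exact_mod_cast ht.ne'
    field_simp
  rw [h2]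
  have h3 : (0 : ℝ) < (2 * Real.pi * t) ^ ((d : ℝ) / 2) := by
    have := Real.pi_pos
    positivity
  rw [← Complex.ofReal_mul, inv_mul_cancel₀ h3.ne', Complex.ofReal_one, one_mul, Complex.I_sq]
  congr 1
  have : (t : ℂ) ≠ 0 := by exact_mod_cast ht.ne'
  push_cast
  field_simp
  ring

lemma integrable_heatKernel {t : ℝ} (ht : 0 < t) :
    Integrable (heatKernel t : EuclideanSpace ℝ (Fin d) → ℝ) := by
  have h := integral_heatKernel_mul_cexp ht (0 : EuclideanSpace ℝ (Fin d))
  simp only [inner_zero_right, Complex.ofReal_zero, zero_mul, Complex.exp_zero, mul_one] at h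
  have h1 : Integrable (fun x : EuclideanSpace ℝ (Fin d) ↦ (heatKernel t x : ℂ)) := by
    -- The integral of a non-integrable function is `0` by convention, so a nonzero value proves
    -- integrability.
    refine not_imp_comm.1 integral_undef ?_
    rw [h]
    exact Complex.exp_ne_zero _
  exact h1.re

lemma integral_heatKernel {t : ℝ} (ht : 0 < t) :
    ∫ x : EuclideanSpace ℝ (Fin d), heatKernel t x = 1 := by
  have h := integral_heatKernel_mul_cexp ht (0 : EuclideanSpace ℝ (Fin d))
  simp only [inner_zero_right, Complex.ofReal_zero, zero_mul, Complex.exp_zero, mul_one] at h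
  rw [integral_complex_ofReal] at h
  simpa using h

/-- The density of a translated Gaussian distribution. -/
lemma heatKernel_sub {t : ℝ} (ht : 0 < t) (a x : EuclideanSpace ℝ (Fin d)) :
    heatKernel t (x - a) =
      heatKernel t x * Real.exp (inner ℝ a x / t - ‖a‖ ^ 2 / (2 * t)) := by
  rw [heatKernel, heatKernel, mul_assoc (_⁻¹), ← Real.exp_add, norm_sub_sq_real, real_inner_comm]
  congr 2
  field_simp
  ring

/-- Completing the square: the right side consists of translated kernels of mass one, so the
chi-square distance of two translates integrates to $e^{\|a\|^2/t}-1$. -/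
lemma heatKernel_mul_sq {t : ℝ} (ht : 0 < t) (a x : EuclideanSpace ℝ (Fin d)) :
    heatKernel t x * (Real.exp (inner ℝ a x / t - ‖a‖ ^ 2 / (2 * t)) - 1) ^ 2 =
      Real.exp (‖a‖ ^ 2 / t) * heatKernel t (x - (2 : ℝ) • a) - 2 * heatKernel t (x - a) +
        heatKernel t x := by
  rw [heatKernel_sub ht, heatKernel_sub ht]
  have h : Real.exp (‖a‖ ^ 2 / t) *
      Real.exp (inner ℝ ((2 : ℝ) • a) x / t - ‖(2 : ℝ) • a‖ ^ 2 / (2 * t)) =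
      Real.exp (inner ℝ a x / t - ‖a‖ ^ 2 / (2 * t)) ^ 2 := by
    rw [← Real.exp_add, ← Real.exp_nat_mul, real_inner_smul_left, norm_smul]
    congr 1
    simp
    field_simp
    ring
  linear_combination -(heatKernel t x) * h

/-- The smoothing effect of convolution with a Gaussian distribution of large variance. -/
lemma abs_integral_heatKernel_sub_le {t : ℝ} (ht : 0 < t) {u : EuclideanSpace ℝ (Fin d) → ℝ}
    (hu : Measurable u) (hu0 : ∀ x, 0 ≤ u x) (hu1 : ∀ x, u x ≤ 1)
    (x y : EuclideanSpace ℝ (Fin d)) {ε : ℝ} (hε : 0 < ε)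
    (h : Real.exp (‖x - y‖ ^ 2 / t) - 1 ≤ ε ^ 2) :
    |(∫ z, heatKernel t z * u (x + z)) - ∫ z, heatKernel t z * u (y + z)| ≤ ε := by
  set a := x - y with ha
  have hi : Integrable (heatKernel t : EuclideanSpace ℝ (Fin d) → ℝ) := integrable_heatKernel ht
  have hia (b : EuclideanSpace ℝ (Fin d)) : Integrable fun z ↦ heatKernel t (z - b) :=
    hi.comp_sub_right b
  -- Translation moves the change of starting point from `u` to the kernel.
  have h1 : ∫ z, heatKernel t z * u (x + z) = ∫ z, heatKernel t (z - a) * u (y + z) := by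
    rw [← integral_sub_right_eq_self (fun z ↦ heatKernel t z * u (x + z)) a]
    congr 1 with z
    rw [ha]
    congr 2
    abel
  have hbd (v : EuclideanSpace ℝ (Fin d) → ℝ) (hv : Integrable v) :
      Integrable fun z ↦ v z * u (y + z) :=
    hv.mul_bdd (c := 1) (hu.comp (measurable_const_add y)).aestronglyMeasurable (ae_of_all _ fun z ↦ by
      rw [Real.norm_eq_abs, abs_of_nonneg (hu0 _)]; exact hu1 _)
  rw [h1, ← integral_sub (hbd _ (hia a)) (hbd _ hi)]
  set L : EuclideanSpace ℝ (Fin d) → ℝ :=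
    fun z ↦ Real.exp (inner ℝ a z / t - ‖a‖ ^ 2 / (2 * t)) - 1 with hL
  have h2 : ∫ z, heatKernel t z * L z ^ 2 = Real.exp (‖a‖ ^ 2 / t) - 1 := by
    simp_rw [hL, heatKernel_mul_sq ht]
    rw [integral_add (f := fun z ↦ Real.exp (‖a‖ ^ 2 / t) * heatKernel t (z - (2 : ℝ) • a) -
      2 * heatKernel t (z - a)) (((hia _).const_mul _).sub ((hia _).const_mul _)) hi,
      integral_sub ((hia _).const_mul _) ((hia _).const_mul _), integral_const_mul,
      integral_const_mul, integral_sub_right_eq_self, integral_sub_right_eq_self,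
      integral_heatKernel ht]
    ring
  have h3 : Integrable fun z ↦ heatKernel t z * L z ^ 2 := by
    simp_rw [hL, heatKernel_mul_sq ht]
    exact ((((hia _).const_mul _).sub ((hia _).const_mul _))).add hi
  -- This is $|L|\le \varepsilon/2+L^2/(2\varepsilon)$; after integration each half contributes at
  -- most $\varepsilon/2$.
  have h4 : ∀ z, ‖heatKernel t (z - a) * u (y + z) - heatKernel t z * u (y + z)‖ ≤
      (ε / 2) * heatKernel t z + (1 / (2 * ε)) * (heatKernel t z * L z ^ 2) := by
    intro z
    have e1 : heatKernel t (z - a) * u (y + z) - heatKernel t z * u (y + z) =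
        heatKernel t z * (L z * u (y + z)) := by
      rw [heatKernel_sub ht, hL]; ring
    have e2 : (ε / 2) * heatKernel t z + (1 / (2 * ε)) * (heatKernel t z * L z ^ 2) =
        heatKernel t z * (ε / 2 + L z ^ 2 / (2 * ε)) := by
      field_simp
    rw [e1, e2, norm_mul, Real.norm_eq_abs, abs_of_pos (heatKernel_pos ht z)]
    refine mul_le_mul_of_nonneg_left ?_ (heatKernel_pos ht z).le
    rw [norm_mul, Real.norm_eq_abs, Real.norm_eq_abs, abs_of_nonneg (hu0 _)]
    refine (mul_le_of_le_one_right (abs_nonneg _) (hu1 _)).trans ?_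
    have e3 : ε / 2 + L z ^ 2 / (2 * ε) - |L z| = (|L z| - ε) ^ 2 / (2 * ε) := by
      rw [← sq_abs (L z)]
      field_simp
      ring
    have e4 : 0 ≤ (|L z| - ε) ^ 2 / (2 * ε) := by positivity
    linarith
  rw [← Real.norm_eq_abs]
  refine (norm_integral_le_of_norm_le ((hi.const_mul _).add (h3.const_mul _))
    (ae_of_all _ h4)).trans ?_
  simp only [Pi.add_apply]
  rw [integral_add (hi.const_mul _) (h3.const_mul _), integral_const_mul, integral_const_mul, h2,
    integral_heatKernel ht]
  calc ε / 2 * 1 + 1 / (2 * ε) * (Real.exp (‖a‖ ^ 2 / t) - 1)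
      ≤ ε / 2 * 1 + 1 / (2 * ε) * ε ^ 2 := by gcongr
    _ = ε := by field_simp; ring

variable {Ω : Type*} [MeasurableSpace Ω] {P : Measure Ω}
  {W : ℝ≥0 → Ω → EuclideanSpace ℝ (Fin d)}

lemma IsBrownianMotion.map_eval (hW : IsBrownianMotion W P) {t : ℝ≥0} (ht : 0 < t) :
    P.map (W t) = volume.withDensity fun x ↦ ENNReal.ofReal (heatKernel t x) := by
  have := hW.isProbabilityMeasure
  have ht' : (0 : ℝ) < t := ht
  have hi : Integrable (heatKernel (t : ℝ) : EuclideanSpace ℝ (Fin d) → ℝ) :=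
    integrable_heatKernel ht'
  have : IsFiniteMeasure
      ((volume : Measure (EuclideanSpace ℝ (Fin d))).withDensity
        fun x ↦ ENNReal.ofReal (heatKernel t x)) := by
    refine isFiniteMeasure_withDensity ?_
    rw [← ofReal_integral_eq_lintegral_ofReal hi (ae_of_all _ fun x ↦ (heatKernel_pos ht' x).le)]
    exact ENNReal.ofReal_ne_top
  have := Measure.isProbabilityMeasure_map (hW.aemeasurable t)
  refine Measure.ext_of_charFun ?_
  ext w
  have h1 : iIndepFun (fun (i : Fin d) ω ↦ W t ω i) P :=
    hW.indep.comp (fun _ f ↦ f t) fun _ ↦ measurable_pi_apply t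
  have h2 := (iIndepFun_iff_charFun_pi
    fun i ↦ (hW.coord i).toIsPreBrownianReal.aemeasurable t).1 h1 w
  have h3 (i : Fin d) : P.map (fun ω ↦ W t ω i) = gaussianReal 0 t :=
    ((hW.coord i).toIsPreBrownianReal.hasLaw_eval t).map_eq
  simp_rw [h3, charFun_gaussianReal] at h2
  refine h2.trans ?_
  rw [charFun_apply, integral_withDensity_eq_integral_toReal_smul
    (measurable_heatKernel _).ennreal_ofReal (ae_of_all _ fun _ ↦ ENNReal.ofReal_lt_top)]
  simp_rw [ENNReal.toReal_ofReal (heatKernel_pos ht' _).le, Complex.real_smul]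
  rw [integral_heatKernel_mul_cexp ht', ← Complex.exp_sum]
  congr 1
  rw [← Complex.ofReal_pow, EuclideanSpace.real_norm_sq_eq]
  push_cast
  rw [Finset.mul_sum, Finset.sum_div, ← Finset.sum_neg_distrib]
  refine Finset.sum_congr rfl fun i _ ↦ ?_
  simp

lemma IsBrownianMotion.volume_absolutelyContinuous_map (hW : IsBrownianMotion W P) {t : ℝ≥0}
    (ht : 0 < t) : volume ≪ P.map (W t) := by
  rw [hW.map_eval ht]
  refine withDensity_absolutelyContinuous' (measurable_heatKernel _).ennreal_ofReal.aemeasurable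
    (ae_of_all _ fun x ↦ ?_)
  simpa using heatKernel_pos (NNReal.coe_pos.2 ht) x

lemma IsBrownianMotion.map_absolutelyContinuous_volume (hW : IsBrownianMotion W P) {t : ℝ≥0}
    (ht : 0 < t) : P.map (W t) ≪ volume := by
  rw [hW.map_eval ht]
  exact withDensity_absolutelyContinuous _ _

/-- The distributions of Brownian motion started from two points become indistinguishable. -/
lemma IsBrownianMotion.tendsto_integral_sub (hW : IsBrownianMotion W P)
    {u : EuclideanSpace ℝ (Fin d) → ℝ}
    (hu : Measurable u) (hu0 : ∀ x, 0 ≤ u x) (hu1 : ∀ x, u x ≤ 1)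
    (x y : EuclideanSpace ℝ (Fin d)) :
    Tendsto (fun n : ℕ ↦ (∫ ω, u (x + W n ω) ∂P) - ∫ ω, u (y + W n ω) ∂P) atTop (𝓝 0) := by
  have h1 {t : ℝ≥0} (ht : 0 < t) (x : EuclideanSpace ℝ (Fin d)) :
      ∫ ω, u (x + W t ω) ∂P = ∫ z, heatKernel t z * u (x + z) := by
    have e : ∫ ω, u (x + W t ω) ∂P = ∫ z, u (x + z) ∂(P.map (W t)) :=
      (integral_map (hW.aemeasurable t)
        (hu.comp (measurable_const_add x)).aestronglyMeasurable).symm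
    rw [e, hW.map_eval ht, integral_withDensity_eq_integral_toReal_smul
      (measurable_heatKernel _).ennreal_ofReal (ae_of_all _ fun _ ↦ ENNReal.ofReal_lt_top)]
    simp_rw [ENNReal.toReal_ofReal (heatKernel_pos (NNReal.coe_pos.2 ht) _).le, smul_eq_mul]
  have h2 : Tendsto (fun n : ℕ ↦ Real.exp (‖x - y‖ ^ 2 / (n : ℝ)) - 1) atTop (𝓝 0) := by
    have := (Real.continuous_exp.tendsto 0).comp
      (tendsto_const_div_atTop_nhds_zero_nat (‖x - y‖ ^ 2))
    simpa using this.sub_const 1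
  rw [Metric.tendsto_nhds]
  intro ε hε
  filter_upwards [h2.eventually_le_const (show (0 : ℝ) < (ε / 2) ^ 2 by positivity),
    eventually_gt_atTop 0] with n hn hn0
  have hn0' : (0 : ℝ≥0) < n := by exact_mod_cast hn0
  rw [dist_zero_right, h1 hn0', h1 hn0', Real.norm_eq_abs]
  refine (abs_integral_heatKernel_sub_le (NNReal.coe_pos.2 hn0') hu hu0 hu1 x y (half_pos hε)
    (by simpa using hn)).trans_lt (half_lt_self hε)

end HeatKernel

/-! ### Measurable hitting events and avoidance probabilities. -/

section Hitting

open Filter Topology Metric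
open scoped ENNReal

variable {d : ℕ}

/-- The paths that come arbitrarily close to `C` up to time `T`, tested along a countable dense set
of times. A continuous path has this property iff it hits the closed set `C` up to time `T`. -/
def hitBy (C : Set (EuclideanSpace ℝ (Fin d))) (T : ℝ≥0) :
    Set (ℝ≥0 → EuclideanSpace ℝ (Fin d)) :=
  {f | ⨅ m, infEDist (f (min (TopologicalSpace.denseSeq ℝ≥0 m) T)) C = 0}

lemma measurableSet_hitBy (C : Set (EuclideanSpace ℝ (Fin d))) (T : ℝ≥0) :
    MeasurableSet (hitBy C T) := by
  have h : Measurable fun f : ℝ≥0 → EuclideanSpace ℝ (Fin d) ↦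
      ⨅ m, infEDist (f (min (TopologicalSpace.denseSeq ℝ≥0 m) T)) C :=
    Measurable.iInf fun m ↦ measurable_infEDist.comp (measurable_pi_apply _)
  exact h (measurableSet_singleton 0)

lemma hitBy_comp_min {C : Set (EuclideanSpace ℝ (Fin d))} {T : ℝ≥0}
    {f : ℝ≥0 → EuclideanSpace ℝ (Fin d)} :
    (fun t ↦ f (min t T)) ∈ hitBy C T ↔ f ∈ hitBy C T := by
  simp [hitBy]

lemma mem_hitBy_iff {C : Set (EuclideanSpace ℝ (Fin d))} (hC : IsClosed C) {T : ℝ≥0}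
    {f : ℝ≥0 → EuclideanSpace ℝ (Fin d)} (hf : Continuous f) :
    f ∈ hitBy C T ↔ ∃ t ≤ T, f t ∈ C := by
  have hg : Continuous fun t ↦ infEDist (f t) C := continuous_infEDist.comp hf
  constructor
  · intro h
    obtain ⟨t, ht, hmin⟩ := (isCompact_Icc (a := (0 : ℝ≥0)) (b := T)).exists_isMinOn
      ⟨0, by simp⟩ hg.continuousOn
    refine ⟨t, ht.2, (mem_iff_infEDist_zero_of_closed hC).2 ?_⟩
    refine le_antisymm ?_ zero_le
    calc infEDist (f t) C
        ≤ ⨅ m, infEDist (f (min (TopologicalSpace.denseSeq ℝ≥0 m) T)) C :=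
          le_iInf fun m ↦ hmin ⟨zero_le, min_le_right _ _⟩
      _ = 0 := h
  · rintro ⟨t, ht, htC⟩
    refine le_antisymm (le_of_forall_gt fun c hc ↦ ?_) zero_le
    have hg' : Continuous fun s ↦ infEDist (f (min s T)) C := hg.comp (by fun_prop)
    have hne : t ∈ {s | infEDist (f (min s T)) C < c} := by
      simpa [min_eq_left ht, infEDist_zero_of_mem htC] using hc
    obtain ⟨m, hm⟩ := (TopologicalSpace.denseRange_denseSeq ℝ≥0).exists_mem_open
      (isOpen_lt hg' continuous_const) ⟨t, hne⟩
    exact (iInf_le _ m).trans_lt hm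

/-- The paths that hit `C`, up to the measurability issues that `hitBy` takes care of. -/
def hitPaths (C : Set (EuclideanSpace ℝ (Fin d))) : Set (ℝ≥0 → EuclideanSpace ℝ (Fin d)) :=
  ⋃ n : ℕ, hitBy C n

lemma measurableSet_hitPaths (C : Set (EuclideanSpace ℝ (Fin d))) :
    MeasurableSet (hitPaths C) :=
  MeasurableSet.iUnion fun _ ↦ measurableSet_hitBy _ _

lemma mem_hitPaths_iff {C : Set (EuclideanSpace ℝ (Fin d))} (hC : IsClosed C)
    {f : ℝ≥0 → EuclideanSpace ℝ (Fin d)} (hf : Continuous f) :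
    f ∈ hitPaths C ↔ ∃ t, f t ∈ C := by
  simp only [hitPaths, Set.mem_iUnion, mem_hitBy_iff hC hf]
  constructor
  · rintro ⟨n, t, -, h⟩
    exact ⟨t, h⟩
  · rintro ⟨t, h⟩
    obtain ⟨n, hn⟩ := exists_nat_ge t
    exact ⟨n, t, hn, h⟩

lemma hitEvent_eq {Ω : Type*} {W : ℝ≥0 → Ω → EuclideanSpace ℝ (Fin d)}
    {C : Set (EuclideanSpace ℝ (Fin d))} (hC : IsClosed C) (cW : ∀ ω, Continuous (W · ω))
    (x : EuclideanSpace ℝ (Fin d)) :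
    hitEvent W C x = {ω | (fun t ↦ x + W t ω) ∈ hitPaths C} := by
  ext ω
  have := cW ω
  exact (mem_hitPaths_iff hC (by fun_prop)).symm

variable {Ω : Type*} [MeasurableSpace Ω]

/-- The probability that the process `x + W` does not hit `C`. -/
noncomputable def avoidProb (W : ℝ≥0 → Ω → EuclideanSpace ℝ (Fin d)) (P : Measure Ω)
    (C : Set (EuclideanSpace ℝ (Fin d))) (x : EuclideanSpace ℝ (Fin d)) : ℝ≥0∞ :=
  P {ω | (fun t ↦ x + W t ω) ∉ hitPaths C}

variable {P : Measure Ω} {W : ℝ≥0 → Ω → EuclideanSpace ℝ (Fin d)}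
  {C : Set (EuclideanSpace ℝ (Fin d))}

lemma avoidProb_le_one [IsProbabilityMeasure P] (x : EuclideanSpace ℝ (Fin d)) :
    avoidProb W P C x ≤ 1 := prob_le_one

lemma measurable_avoidProb [IsProbabilityMeasure P] (mW : ∀ t, Measurable (W t)) :
    Measurable (avoidProb W P C) := by
  have h : Measurable fun (p : EuclideanSpace ℝ (Fin d) × Ω) (t : ℝ≥0) ↦ p.1 + W t p.2 :=
    measurable_pi_lambda _ fun t ↦ measurable_fst.add ((mW t).comp measurable_snd)
  exact measurable_measure_prodMk_left (h (measurableSet_hitPaths C).compl)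

lemma avoidProb_eq_zero_of_mem (hC : IsClosed C) (cW : ∀ ω, Continuous (W · ω))
    (zW : ∀ ω, W 0 ω = 0) {x : EuclideanSpace ℝ (Fin d)} (hx : x ∈ C) :
    avoidProb W P C x = 0 := by
  have h : {ω | (fun t ↦ x + W t ω) ∉ hitPaths C} = ∅ := by
    ext ω
    have := cW ω
    simp only [Set.mem_ofPred_eq, Set.mem_empty_iff_false, iff_false, not_not]
    exact (mem_hitPaths_iff hC (by fun_prop)).2 ⟨0, by simpa [zW] using hx⟩
  rw [avoidProb, h, measure_empty]

lemma avoidableFrom_iff [IsProbabilityMeasure P] (hC : IsClosed C) (mW : ∀ t, Measurable (W t))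
    (cW : ∀ ω, Continuous (W · ω)) (x : EuclideanSpace ℝ (Fin d)) :
    AvoidableFrom W P C x ↔ avoidProb W P C x ≠ 0 := by
  have hm : MeasurableSet {ω | (fun t ↦ x + W t ω) ∈ hitPaths C} :=
    measurableSet_preimage (by fun_prop) (measurableSet_hitPaths C)
  have h := prob_compl_eq_zero_iff hm (μ := P)
  rw [AvoidableFrom, hitEvent_eq hC cW, avoidProb, ← Set.compl_ofPred, ne_eq, h]
  exact prob_le_one.lt_iff_ne

lemma avoidableFrom_congr {V : ℝ≥0 → Ω → EuclideanSpace ℝ (Fin d)}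
    (h : ∀ᵐ ω ∂P, ∀ t, W t ω = V t ω) (x : EuclideanSpace ℝ (Fin d)) :
    AvoidableFrom W P C x ↔ AvoidableFrom V P C x := by
  have : hitEvent W C x =ᵐ[P] hitEvent V C x := by
    filter_upwards [h] with ω hω
    have h1 : ω ∈ hitEvent W C x ↔ ω ∈ hitEvent V C x := by
      simp only [hitEvent, Set.mem_ofPred_eq, hω]
    exact propext h1
  rw [AvoidableFrom, AvoidableFrom, measure_congr this]

/-- Inclusion–exclusion: avoiding `A` and avoiding `B` together mean avoiding the union. -/
lemma avoidProb_add_le [IsProbabilityMeasure P] {A B : Set (EuclideanSpace ℝ (Fin d))}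
    (hA : IsClosed A) (hB : IsClosed B) (mW : ∀ t, Measurable (W t))
    (cW : ∀ ω, Continuous (W · ω)) (x : EuclideanSpace ℝ (Fin d)) :
    avoidProb W P A x + avoidProb W P B x ≤ 1 + avoidProb W P (A ∪ B) x := by
  have hm : MeasurableSet {ω | (fun t ↦ x + W t ω) ∉ hitPaths B} :=
    measurableSet_preimage (by fun_prop) (measurableSet_hitPaths B).compl
  rw [avoidProb, avoidProb, ← measure_union_add_inter _ hm]
  refine add_le_add prob_le_one (measure_mono ?_)
  rintro ω ⟨h1, h2⟩ h3
  have hc : Continuous fun t ↦ x + W t ω := by have := cW ω; fun_prop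
  obtain ⟨t, ht | ht⟩ := (mem_hitPaths_iff (hA.union hB) hc).1 h3
  · exact h1 ((mem_hitPaths_iff hA hc).2 ⟨t, ht⟩)
  · exact h2 ((mem_hitPaths_iff hB hc).2 ⟨t, ht⟩)

/-! ### Markov property and long-time behaviour of the avoidance probability. -/

namespace IsBrownianMotion

/-- The Markov property, in integrated form. -/
lemma measure_past_inter_future (hW : IsBrownianMotion W P) (mW : ∀ t, Measurable (W t)) (s : ℝ≥0)
    {α : Set (Set.Iic s → EuclideanSpace ℝ (Fin d))} (hα : MeasurableSet α)
    {K : Set (ℝ≥0 → EuclideanSpace ℝ (Fin d))} (hK : MeasurableSet K)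
    (x : EuclideanSpace ℝ (Fin d)) :
    P ({ω | (fun t : Set.Iic s ↦ W t ω) ∈ α} ∩ {ω | (fun t ↦ x + W (s + t) ω) ∈ K}) =
      ∫⁻ ω in {ω | (fun t : Set.Iic s ↦ W t ω) ∈ α},
        P {ω' | (fun t ↦ x + W s ω + W t ω') ∈ K} ∂P := by
  classical
  have := hW.isProbabilityMeasure
  have mpast : Measurable fun ω (t : Set.Iic s) ↦ W t ω := by fun_prop
  have mfut : Measurable fun ω t ↦ W (s + t) ω - W s ω := by fun_prop
  have mpath : Measurable fun ω t ↦ W t ω := by fun_prop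
  have := Measure.isProbabilityMeasure_map (μ := P) mpath.aemeasurable
  have hlaw := hW.map_eq (hW.shift s) mW fun t ↦ (mW _).sub (mW _)
  have hprod := (indepFun_iff_map_prod_eq_prod_map_map mpast.aemeasurable mfut.aemeasurable).1
    (hW.indepFun_shift s)
  rw [← hlaw] at hprod
  let e : Set.Iic s := ⟨s, Set.mem_Iic.2 le_rfl⟩
  -- The event in terms of the past and the independent increments after `s`; `e` is the last time
  -- of the past.
  let S : Set ((Set.Iic s → EuclideanSpace ℝ (Fin d)) × (ℝ≥0 → EuclideanSpace ℝ (Fin d))) :=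
    {p | p.1 ∈ α ∧ (fun t ↦ x + p.1 e + p.2 t) ∈ K}
  have hS : MeasurableSet S :=
    (measurable_fst hα).inter (measurableSet_preimage (by fun_prop) hK)
  have h1 : ({ω | (fun t : Set.Iic s ↦ W t ω) ∈ α} ∩ {ω | (fun t ↦ x + W (s + t) ω) ∈ K}) =
      (fun ω ↦ ((fun t : Set.Iic s ↦ W t ω), fun t ↦ W (s + t) ω - W s ω)) ⁻¹' S := by
    ext ω
    simp [S, e]
  rw [h1, ← Measure.map_apply (mpast.prodMk mfut) hS, hprod, Measure.prod_apply hS,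
    lintegral_map (measurable_measure_prodMk_left hS) mpast,
    ← lintegral_indicator (s := {ω | (fun t : Set.Iic s ↦ W t ω) ∈ α}) (mpast hα)]
  congr 1 with ω
  by_cases hω : (fun t : Set.Iic s ↦ W t ω) ∈ α
  · rw [Measure.map_apply mpath (measurable_prodMk_left hS)]
    simp [S, e, hω]
  · rw [Measure.map_apply mpath (measurable_prodMk_left hS)]
    simp [S, hω]

lemma lintegral_avoidProb (hW : IsBrownianMotion W P) (mW : ∀ t, Measurable (W t)) (s : ℝ≥0)
    (x : EuclideanSpace ℝ (Fin d)) :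
    ∫⁻ ω, avoidProb W P C (x + W s ω) ∂P = P {ω | (fun t ↦ x + W (s + t) ω) ∉ hitPaths C} := by
  have h := hW.measure_past_inter_future mW s MeasurableSet.univ (measurableSet_hitPaths C).compl x
  simp only [Set.mem_univ, Set.ofPred_true, Set.univ_inter, Measure.restrict_univ] at h
  exact h.symm

/-- Avoiding `C` forever is avoiding it up to `s` and then, restarted at the current position,
avoiding it forever. -/
lemma avoidProb_eq_setLIntegral (hW : IsBrownianMotion W P) (mW : ∀ t, Measurable (W t))
    (cW : ∀ ω, Continuous (W · ω)) (hC : IsClosed C) (s : ℝ≥0) (x : EuclideanSpace ℝ (Fin d)) :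
    avoidProb W P C x =
      ∫⁻ ω in {ω | (fun t ↦ x + W t ω) ∉ hitBy C s}, avoidProb W P C (x + W s ω) ∂P := by
  -- Freezing the path at time `s` displays the event as one of the past alone.
  let α : Set (Set.Iic s → EuclideanSpace ℝ (Fin d)) :=
    {π | (fun t ↦ x + π ⟨min t s, Set.mem_Iic.2 (min_le_right _ _)⟩) ∉ hitBy C s}
  have hα : MeasurableSet α :=
    measurableSet_preimage (by fun_prop) (measurableSet_hitBy C s).compl
  have h1 : {ω | (fun t ↦ x + W t ω) ∉ hitBy C s} =
      {ω | (fun t : Set.Iic s ↦ W t ω) ∈ α} := by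
    ext ω
    exact not_congr (hitBy_comp_min (f := fun t ↦ x + W t ω)).symm
  have h := hW.measure_past_inter_future mW s hα (measurableSet_hitPaths C).compl x
  rw [h1]
  refine Eq.trans ?_ h
  rw [← h1, avoidProb]
  congr 1
  ext ω
  have hc : Continuous fun t ↦ x + W t ω := by have := cW ω; fun_prop
  have hc' : Continuous fun t ↦ x + W (s + t) ω := hc.comp (continuous_const_add s)
  simp only [Set.mem_ofPred_eq, Set.mem_inter_iff, Set.mem_compl_iff, mem_hitPaths_iff hC hc,
    mem_hitPaths_iff hC hc', mem_hitBy_iff hC hc]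
  push Not
  refine ⟨fun h ↦ ⟨fun t _ ↦ h t, fun t ↦ h _⟩, fun h t ↦ ?_⟩
  rcases le_total t s with hts | hts
  · exact h.1 t hts
  · obtain ⟨r, rfl⟩ := exists_add_of_le hts
    exact h.2 r

lemma avoidProb_le_lintegral (hW : IsBrownianMotion W P) (mW : ∀ t, Measurable (W t))
    (cW : ∀ ω, Continuous (W · ω)) (hC : IsClosed C) (s : ℝ≥0) (x : EuclideanSpace ℝ (Fin d)) :
    avoidProb W P C x ≤ ∫⁻ ω, avoidProb W P C (x + W s ω) ∂P := by
  rw [hW.avoidProb_eq_setLIntegral mW cW hC s x]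
  exact setLIntegral_le_lintegral _ _

/-- If a closed set is avoidable from some point, then from every point the probability that it is
hit after time `n` tends to zero as `n` tends to infinity. -/
lemma tendsto_lintegral_avoidProb (hW : IsBrownianMotion W P) (mW : ∀ t, Measurable (W t))
    (cW : ∀ ω, Continuous (W · ω)) (hC : IsClosed C) {p : EuclideanSpace ℝ (Fin d)}
    (hp : avoidProb W P C p ≠ 0) (x : EuclideanSpace ℝ (Fin d)) :
    Tendsto (fun n : ℕ ↦ ∫⁻ ω, avoidProb W P C (x + W n ω) ∂P) atTop (𝓝 1) := by
  have := hW.isProbabilityMeasure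
  set v := avoidProb W P C with hv
  have mv : Measurable v := measurable_avoidProb mW
  have hv1 : ∀ x, v x ≤ 1 := avoidProb_le_one
  set Q : ℕ → EuclideanSpace ℝ (Fin d) → ℝ≥0∞ := fun n x ↦ ∫⁻ ω, v (x + W n ω) ∂P with hQ
  have hQ1 (n x) : Q n x ≤ 1 := by
    calc Q n x ≤ ∫⁻ _, 1 ∂P := lintegral_mono fun ω ↦ hv1 _
      _ = 1 := by simp
  have hmono (x) : Monotone fun n ↦ Q n x := by
    intro m n hmn
    simp only [hQ, hv, hW.lintegral_avoidProb mW]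
    refine measure_mono fun ω hω ↦ ?_
    have hc (s : ℝ≥0) : Continuous fun t ↦ x + W (s + t) ω := by
      have := cW ω
      fun_prop
    simp only [Set.mem_ofPred_eq, mem_hitPaths_iff hC (hc _)] at hω ⊢
    rintro ⟨t, ht⟩
    refine hω ⟨(n - m : ℕ) + t, ?_⟩
    rwa [← add_assoc, ← Nat.cast_add, Nat.add_sub_cancel' hmn]
  have hlim (x) : Tendsto (fun n ↦ Q n x) atTop (𝓝 (⨆ n, Q n x)) := tendsto_atTop_iSup (hmono x)
  have hfin (x) : (⨆ n, Q n x) ≠ ∞ :=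
    ((iSup_le fun n ↦ hQ1 n x).trans_lt ENNReal.one_lt_top).ne
  -- The limit forgets the starting point because the laws of `x + W n` and `y + W n` merge.
  have hconst (x y) : ⨆ n, Q n x = ⨆ n, Q n y := by
    rw [← ENNReal.toReal_eq_toReal_iff' (hfin x) (hfin y), ← sub_eq_zero]
    have h1 := hW.tendsto_integral_sub (u := fun x ↦ (v x).toReal) mv.ennreal_toReal
      (fun _ ↦ ENNReal.toReal_nonneg) (fun z ↦ ENNReal.toReal_mono ENNReal.one_ne_top (hv1 z)) x y
    have h2 (n : ℕ) (z) : ∫ ω, (v (z + W n ω)).toReal ∂P = (Q n z).toReal :=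
      integral_toReal (mv.comp ((mW n).const_add z)).aemeasurable
        (ae_of_all _ fun ω ↦ (hv1 _).trans_lt ENNReal.one_lt_top)
    simp_rw [h2] at h1
    exact tendsto_nhds_unique (((ENNReal.tendsto_toReal (hfin x)).comp (hlim x)).sub
      ((ENNReal.tendsto_toReal (hfin y)).comp (hlim y))) h1
  set c := ⨆ n, Q n x with hc
  have hvc (z) : v z ≤ c := by
    rw [hc, hconst x z]
    exact (hW.avoidProb_le_lintegral mW cW hC (0 : ℕ) z).trans (le_iSup (fun n ↦ Q n z) 0)
  have hm (n : ℕ) : MeasurableSet {ω | (fun t ↦ p + W t ω) ∉ hitBy C n} :=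
    measurableSet_preimage (by fun_prop) (measurableSet_hitBy C n).compl
  have hle (n : ℕ) : v p ≤ c * P {ω | (fun t ↦ p + W t ω) ∉ hitBy C n} := by
    rw [hv, hW.avoidProb_eq_setLIntegral mW cW hC n p]
    calc _ ≤ ∫⁻ _ in {ω | (fun t ↦ p + W t ω) ∉ hitBy C n}, c ∂P :=
          lintegral_mono fun ω ↦ hvc _
      _ = _ := by simp
  have htend : Tendsto (fun n : ℕ ↦ P {ω | (fun t ↦ p + W t ω) ∉ hitBy C n}) atTop
      (𝓝 (v p)) := by
    have h1 : {ω | (fun t ↦ p + W t ω) ∉ hitPaths C} =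
        ⋂ n : ℕ, {ω | (fun t ↦ p + W t ω) ∉ hitBy C n} := by
      ext ω
      simp [hitPaths]
    rw [hv, avoidProb, h1]
    refine tendsto_measure_iInter_atTop (fun n ↦ (hm n).nullMeasurableSet) ?_
      ⟨0, measure_ne_top _ _⟩
    intro m n hmn ω hω
    have hcont : Continuous fun t ↦ p + W t ω := by have := cW ω; fun_prop
    simp only [Set.mem_ofPred_eq, mem_hitBy_iff hC hcont] at hω ⊢
    rintro ⟨t, ht, htC⟩
    exact hω ⟨t, ht.trans (by exact_mod_cast hmn), htC⟩
  -- Let `n` tend to infinity in `hle`; as `v p` is positive and finite, it cancels and leaves `1 ≤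
  -- c`.
  have hle' : v p ≤ c * v p :=
    ge_of_tendsto' (ENNReal.Tendsto.const_mul htend (Or.inr (hfin x))) hle
  have hc1 : c = 1 := by
    refine le_antisymm (iSup_le fun n ↦ hQ1 n x) ?_
    have h2 : v p * 1 ≤ v p * c := by rwa [mul_one, mul_comm]
    exact (ENNReal.mul_le_mul_iff_right hp ((hv1 p).trans_lt ENNReal.one_lt_top).ne).1 h2
  have := hlim x
  rwa [← hc, hc1] at this

lemma exists_avoidProb_union_ne_zero (hW : IsBrownianMotion W P) (mW : ∀ t, Measurable (W t))
    (cW : ∀ ω, Continuous (W · ω)) {A B : Set (EuclideanSpace ℝ (Fin d))}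
    (hA : IsClosed A) (hB : IsClosed B) {p q : EuclideanSpace ℝ (Fin d)}
    (hp : avoidProb W P A p ≠ 0) (hq : avoidProb W P B q ≠ 0) :
    ∃ x, avoidProb W P (A ∪ B) x ≠ 0 := by
  have := hW.isProbabilityMeasure
  by_contra! h
  have h1 := (hW.tendsto_lintegral_avoidProb mW cW hA hp 0).add
    (hW.tendsto_lintegral_avoidProb mW cW hB hq 0)
  have h2 (n : ℕ) : ∫⁻ ω, avoidProb W P A (0 + W n ω) ∂P +
      ∫⁻ ω, avoidProb W P B (0 + W n ω) ∂P ≤ 1 := by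
    have mA : Measurable fun ω ↦ avoidProb W P A (0 + W n ω) :=
      (measurable_avoidProb mW).comp ((mW n).const_add 0)
    rw [← lintegral_add_left mA]
    calc _ ≤ ∫⁻ _, 1 ∂P := lintegral_mono fun ω ↦ by
            simpa [h] using avoidProb_add_le (P := P) hA hB mW cW (0 + W n ω)
      _ = 1 := by simp
  have h3 := le_of_tendsto' h1 h2
  norm_num at h3

/-! ### Local propagation of zeros, and the dichotomy on a connected complement. -/

/-- The supremum of a Brownian motion over a short time interval is small in probability. -/
lemma tendsto_measure_exists_norm_gt (hW : IsBrownianMotion W P) (mW : ∀ t, Measurable (W t))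
    (cW : ∀ ω, Continuous (W · ω)) (zW : ∀ ω, W 0 ω = 0) {ρ : ℝ} (hρ : 0 < ρ) :
    Tendsto (fun n : ℕ ↦ P {ω | ∃ m : ℕ,
      ρ < ‖W (min (TopologicalSpace.denseSeq ℝ≥0 m) (1 / ((n : ℝ≥0) + 1))) ω‖}) atTop (𝓝 0) := by
  have := hW.isProbabilityMeasure
  rw [← measure_empty (μ := P)]
  refine tendsto_measure_of_ae_tendsto_indicator_of_isFiniteMeasure atTop MeasurableSet.empty
    (fun n ↦ ?_) (ae_of_all _ fun ω ↦ ?_)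
  · simp only [Set.ofPred_exists]
    exact MeasurableSet.iUnion fun m ↦ measurableSet_lt measurable_const (mW _).norm
  · have h1 : Tendsto (fun t ↦ ‖W t ω‖) (𝓝 0) (𝓝 0) := by
      simpa [zW] using (cW ω).norm.tendsto 0
    have h2 : ∀ᶠ t in 𝓝 (0 : ℝ≥0), ‖W t ω‖ < ρ := h1.eventually_lt_const hρ
    obtain ⟨δ, hδ, h3⟩ := Metric.eventually_nhds_iff.1 h2
    have h4 : ∀ᶠ n : ℕ in atTop, (1 : ℝ) / ((n : ℝ) + 1) < δ :=
      tendsto_one_div_add_atTop_nhds_zero_nat.eventually_lt_const hδ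
    filter_upwards [h4] with n hn
    simp only [Set.mem_empty_iff_false, iff_false]
    rintro ⟨m, hm⟩
    refine absurd hm (not_lt.2 ?_)
    refine (h3 ?_).le
    rw [NNReal.dist_eq, NNReal.coe_zero, sub_zero, abs_of_nonneg (NNReal.coe_nonneg _)]
    refine lt_of_le_of_lt ?_ hn
    have : min (TopologicalSpace.denseSeq ℝ≥0 m) (1 / ((n : ℝ≥0) + 1)) ≤ 1 / ((n : ℝ≥0) + 1) :=
      min_le_right _ _
    exact_mod_cast this

/-- The law of `W s` has a density, so the null exceptional set is not seen at time `s`. Only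
excursions beyond `ρ / 2` contribute to the mean of `avoidProb` at `z + W s`, and their probability
vanishes as `s` tends to zero. -/
lemma avoidProb_eq_zero_of_ae_eq_zero (hW : IsBrownianMotion W P) (mW : ∀ t, Measurable (W t))
    (cW : ∀ ω, Continuous (W · ω)) (zW : ∀ ω, W 0 ω = 0) (hC : IsClosed C)
    {z : EuclideanSpace ℝ (Fin d)} {ρ : ℝ} (hρ : 0 < ρ)
    (h : volume {w | ‖w‖ < ρ ∧ avoidProb W P C (z + w) ≠ 0} = 0) :
    avoidProb W P C z = 0 := by
  have := hW.isProbabilityMeasure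
  have mv : Measurable (avoidProb W P C) := measurable_avoidProb mW
  refine le_antisymm (ge_of_tendsto'
    (hW.tendsto_measure_exists_norm_gt mW cW zW (half_pos hρ)) fun n ↦ ?_) zero_le
  set s : ℝ≥0 := 1 / ((n : ℝ≥0) + 1) with hs
  have hs0 : 0 < s := by positivity
  have hN : MeasurableSet {w | ‖w‖ < ρ ∧ avoidProb W P C (z + w) ≠ 0} :=
    (measurableSet_lt measurable_norm measurable_const).inter
      ((mv.comp (measurable_const_add z)) (measurableSet_singleton 0).compl)
  have h1 : P (W s ⁻¹' {w | ‖w‖ < ρ ∧ avoidProb W P C (z + w) ≠ 0}) = 0 := by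
    rw [← Measure.map_apply (mW s) hN]
    exact hW.map_absolutelyContinuous_volume hs0 h
  have h2 : MeasurableSet {ω | ρ / 2 < ‖W s ω‖} := measurableSet_lt measurable_const (mW s).norm
  calc avoidProb W P C z ≤ ∫⁻ ω, avoidProb W P C (z + W s ω) ∂P :=
        hW.avoidProb_le_lintegral mW cW hC s z
    _ ≤ ∫⁻ ω, {ω | ρ / 2 < ‖W s ω‖}.indicator (fun _ ↦ 1) ω ∂P := by
        refine lintegral_mono_ae ?_
        filter_upwards [measure_eq_zero_iff_ae_notMem.1 h1] with ω hω
        by_cases hlt : ρ / 2 < ‖W s ω‖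
        · simpa [hlt] using avoidProb_le_one (P := P) _
        · have h3 : ‖W s ω‖ < ρ := by linarith
          have h4 : avoidProb W P C (z + W s ω) = 0 := by
            by_contra h5
            exact hω ⟨h3, h5⟩
          simp [h4]
    _ = P {ω | ρ / 2 < ‖W s ω‖} := by simp [lintegral_indicator h2]
    _ ≤ _ := measure_mono_ae (by
        -- A dense time beyond `s` is truncated to `s`, so the event at time `s` is one of those in
        -- the union.
        obtain ⟨m, hm⟩ := (TopologicalSpace.denseRange_denseSeq ℝ≥0).exists_mem_open
          isOpen_Ioi ⟨s + 1, show s < s + 1 from lt_add_one s⟩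
        refine ae_of_all _ fun ω hω ↦ ⟨m, ?_⟩
        rw [min_eq_right (le_of_lt hm)]
        exact hω)

/-- If Brownian motion started at `y` hits `C` almost surely, then so it does when started from a
nearby point. -/
lemma avoidProb_eq_zero_of_dist_lt (hW : IsBrownianMotion W P) (mW : ∀ t, Measurable (W t))
    (cW : ∀ ω, Continuous (W · ω)) (zW : ∀ ω, W 0 ω = 0) (hC : IsClosed C)
    {y z : EuclideanSpace ℝ (Fin d)} {r : ℝ} (hr : 0 < r) (hyC : ∀ w ∈ C, 3 * r ≤ dist y w)
    (hy : avoidProb W P C y = 0) (hz : dist z y < r) :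
    avoidProb W P C z = 0 := by
  have := hW.isProbabilityMeasure
  set v := avoidProb W P C with hv
  have mv : Measurable v := measurable_avoidProb mW
  -- With positive probability the path stays within `r / 2` up to time `s`; then the bridge stays
  -- within `r / 2 + r / 2 = r`.
  obtain ⟨n, hn⟩ := ((hW.tendsto_measure_exists_norm_gt mW cW zW
    (half_pos hr)).eventually_lt_const zero_lt_one).exists
  set s : ℝ≥0 := 1 / ((n : ℝ≥0) + 1) with hs
  have hs0 : 0 < s := by positivity
  have hs0' : (0 : ℝ) < s := hs0
  let τ (m : ℕ) : Set.Iic s := 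
    ⟨min (TopologicalSpace.denseSeq ℝ≥0 m) s, Set.mem_Iic.2 (min_le_right _ _)⟩
  let β : Set (Set.Iic s → EuclideanSpace ℝ (Fin d)) := {b | ∀ m, ‖b (τ m)‖ ≤ r}
  have hβ : MeasurableSet β := by
    simp only [β, Set.ofPred_forall]
    exact MeasurableSet.iInter fun m ↦
      measurableSet_le (measurable_pi_apply (τ m)).norm measurable_const
  let b (ω : Ω) (t : Set.Iic s) : EuclideanSpace ℝ (Fin d) := W t ω - ((t : ℝ) / (s : ℝ)) • W s ω
  have hfrac (m : ℕ) : 0 ≤ ((τ m : ℝ≥0) : ℝ) / s ∧ ((τ m : ℝ≥0) : ℝ) / s ≤ 1 :=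
    ⟨by positivity, div_le_one_of_le₀ (NNReal.coe_le_coe.2 (τ m).2) hs0'.le⟩
  obtain ⟨m₀, hm₀⟩ := (TopologicalSpace.denseRange_denseSeq ℝ≥0).exists_mem_open
    isOpen_Ioi ⟨s + 1, show s < s + 1 from lt_add_one s⟩
  have hGpos : P (b ⁻¹' β) ≠ 0 := by
    intro h0
    have hsub : (b ⁻¹' β)ᶜ ⊆ {ω | ∃ m : ℕ,
        r / 2 < ‖W (min (TopologicalSpace.denseSeq ℝ≥0 m) s) ω‖} := by
      intro ω hω
      by_contra hcon
      simp only [Set.mem_ofPred_eq, not_exists, not_lt] at hcon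
      refine hω fun m ↦ ?_
      have e1 := hcon m
      have e2 := hcon m₀
      rw [min_eq_right (le_of_lt hm₀)] at e2
      calc ‖b ω (τ m)‖ ≤ ‖W (τ m) ω‖ + ‖(((τ m : ℝ≥0) : ℝ) / (s : ℝ)) • W s ω‖ := norm_sub_le _ _
        _ ≤ r / 2 + 1 * (r / 2) := by
            rw [norm_smul, Real.norm_of_nonneg (hfrac m).1]
            exact add_le_add e1 (mul_le_mul (hfrac m).2 e2 (norm_nonneg _) zero_le_one)
        _ = r := by ring
    have h1 : P (b ⁻¹' β)ᶜ = 1 := by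
      have mb : Measurable b := by
        simp only [b]
        fun_prop
      rw [prob_compl_eq_one_sub (mb hβ), h0, tsub_zero]
    exact absurd (h1 ▸ measure_mono hsub) (not_le.2 hn)
  let N : Set (EuclideanSpace ℝ (Fin d)) := {w | ‖w‖ < r ∧ v (y + w) ≠ 0}
  have hN : MeasurableSet N := (measurableSet_lt measurable_norm measurable_const).inter
      ((mv.comp (measurable_const_add y)) (measurableSet_singleton 0).compl)
  -- Bridge at most `r` and endpoint below `r` keep the path within `2 * r` of `y`, hence at
  -- distance at least `r` from `C`.
  have hnohit : b ⁻¹' β ∩ W s ⁻¹' N ⊆ {ω | (fun t ↦ y + W t ω) ∉ hitBy C s} := by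
    rintro ω ⟨h1, h2⟩ h3
    have h4 (m : ℕ) : ENNReal.ofReal r ≤
        infEDist (y + W (min (TopologicalSpace.denseSeq ℝ≥0 m) s) ω) C := by
      refine le_infEDist.2 fun w hw ↦ ?_
      rw [edist_dist]
      refine ENNReal.ofReal_le_ofReal ?_
      have e1 : ‖W (τ m) ω‖ ≤ 2 * r := by
        have e3 : W (τ m) ω = b ω (τ m) + (((τ m : ℝ≥0) : ℝ) / (s : ℝ)) • W s ω := by simp [b]
        rw [e3]
        calc _ ≤ ‖b ω (τ m)‖ + ‖(((τ m : ℝ≥0) : ℝ) / (s : ℝ)) • W s ω‖ := norm_add_le _ _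
          _ ≤ r + 1 * r := by
              rw [norm_smul, Real.norm_of_nonneg (hfrac m).1]
              exact add_le_add (h1 m)
                (mul_le_mul (hfrac m).2 h2.1.le (norm_nonneg _) zero_le_one)
          _ = 2 * r := by ring
      have e2 := hyC w hw
      have e4 := dist_triangle y (y + W (τ m) ω) w
      rw [dist_self_add_right] at e4
      change r ≤ dist (y + W (τ m) ω) w
      linarith
    have h5 : ENNReal.ofReal r ≤ 0 := (le_iInf h4).trans_eq h3
    exact absurd (ENNReal.ofReal_eq_zero.1 (le_antisymm h5 zero_le)) (not_le.2 hr)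
  have hzero : P (b ⁻¹' β ∩ W s ⁻¹' N) = 0 := by
    have h1 := hW.avoidProb_eq_setLIntegral mW cW hC s y
    rw [← hv, hy] at h1
    have h2 := (lintegral_eq_zero_iff (mv.comp ((mW s).const_add y))).1 h1.symm
    have h3 : MeasurableSet {ω | (fun t ↦ y + W t ω) ∉ hitBy C s} :=
      measurableSet_preimage (by fun_prop) (measurableSet_hitBy C s).compl
    rw [EventuallyEq, ae_restrict_iff' h3] at h2
    rw [measure_eq_zero_iff_ae_notMem]
    filter_upwards [h2] with ω hω hmem
    exact hmem.2.2 (hω (hnohit hmem))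
  -- Independence of bridge and endpoint factorises the null event. The bridge factor is positive,
  -- so `N` is null for the law of `W s`, and then for Lebesgue measure since the Gaussian density
  -- is positive.
  rw [(hW.indepFun_bridge s hs0.ne').measure_inter_preimage_eq_mul _ _ hβ hN] at hzero
  have hN0 : P (W s ⁻¹' N) = 0 := (mul_eq_zero.1 hzero).resolve_left hGpos
  rw [← Measure.map_apply (mW s) hN] at hN0
  have hvol : volume N = 0 := hW.volume_absolutelyContinuous_map hs0 hN0
  refine hW.avoidProb_eq_zero_of_ae_eq_zero mW cW zW hC (sub_pos.2 hz) ?_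
  have h6 : {w | ‖w‖ < r - dist z y ∧ v (z + w) ≠ 0} ⊆ (fun w ↦ (z - y) + w) ⁻¹' N := by
    rintro w ⟨h7, h8⟩
    refine ⟨?_, ?_⟩
    · have := norm_add_le (z - y) w
      rw [← dist_eq_norm] at this
      linarith
    · rwa [show y + (z - y + w) = z + w by abel]
  exact measure_mono_null h6 (by rw [measure_preimage_add]; exact hvol)

/-- If the complement of a closed set is connected, then either Brownian motion hits the set almost
surely from all points, or it avoids the set with positive probability from all points of the
complement. -/
lemma avoidProb_ne_zero (hW : IsBrownianMotion W P) (mW : ∀ t, Measurable (W t))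
    (cW : ∀ ω, Continuous (W · ω)) (zW : ∀ ω, W 0 ω = 0) (hC : IsClosed C)
    (hconn : IsPreconnected Cᶜ) {x y : EuclideanSpace ℝ (Fin d)}
    (hx : avoidProb W P C x ≠ 0) (hy : y ∈ Cᶜ) : avoidProb W P C y ≠ 0 := by
  have hxC : x ∈ Cᶜ := fun h ↦ hx (avoidProb_eq_zero_of_mem hC cW zW h)
  have hradius {w : EuclideanSpace ℝ (Fin d)} (hw : w ∈ Cᶜ) :
      ∃ r > 0, ∀ z, dist z w < r → z ∈ Cᶜ ∧ ∀ c ∈ C, 3 * r ≤ dist z c := by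
    obtain ⟨ε, hε, hball⟩ := Metric.isOpen_iff.1 hC.isOpen_compl w hw
    have h1 : ∀ c ∈ C, ε ≤ dist w c := fun c hc ↦ by
      by_contra! h
      exact hball (Metric.mem_ball'.2 h) hc
    -- A move of less than `ε / 4` leaves a distance of at least `3 * (ε / 4)` to `C`.
    refine ⟨ε / 4, by positivity, fun z hz ↦ ⟨hball (Metric.mem_ball.2 (by linarith)), ?_⟩⟩
    intro c hc
    have h2 := dist_triangle w z c
    rw [dist_comm w z] at h2
    linarith [h1 c hc]
  have hU : IsOpen {w | w ∈ Cᶜ ∧ avoidProb W P C w = 0} := by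
    refine Metric.isOpen_iff.2 fun w ⟨hw, hw0⟩ ↦ ?_
    obtain ⟨r, hr, h⟩ := hradius hw
    exact ⟨r, hr, fun z hz ↦ ⟨(h z hz).1, hW.avoidProb_eq_zero_of_dist_lt mW cW zW hC hr
      (h w (by simpa using hr)).2 hw0 hz⟩⟩
  have hV : IsOpen {w | w ∈ Cᶜ ∧ avoidProb W P C w ≠ 0} := by
    refine Metric.isOpen_iff.2 fun w ⟨hw, hw0⟩ ↦ ?_
    obtain ⟨r, hr, h⟩ := hradius hw
    exact ⟨r, hr, fun z hz ↦ ⟨(h z hz).1, fun hz0 ↦ hw0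
      (hW.avoidProb_eq_zero_of_dist_lt mW cW zW hC hr (h z hz).2 hz0
        (by rw [dist_comm]; exact hz))⟩⟩
  intro hy0
  obtain ⟨w, -, hw1, hw2⟩ := hconn _ _ hU hV
    (fun w hw ↦ (em (avoidProb W P C w = 0)).imp (fun h ↦ ⟨hw, h⟩) fun h ↦ ⟨hw, h⟩)
    ⟨y, hy, hy, hy0⟩ ⟨x, hxC, hxC, hx⟩
  exact hw2.2 hw1.2

end IsBrownianMotion

end Hitting

/-! ### Conclusion, through a regular version of the Brownian motion. -/

theorem proposition3 {d : ℕ} {Ω : Type*} [MeasurableSpace Ω] {P : Measure Ω}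
    {W : ℝ≥0 → Ω → EuclideanSpace ℝ (Fin d)} (hW : IsBrownianMotion W P)
    {A B : Set (EuclideanSpace ℝ (Fin d))} (hAcl : IsClosed A) (hBcl : IsClosed B)
    (hA : IsAvoidable W P A) (hB : IsAvoidable W P B)
    (hAB : IsConnected (A ∪ B)ᶜ) :
    IsAvoidable W P (A ∪ B) ∧ ∀ p ∉ A ∪ B, AvoidableFrom W P (A ∪ B) p := by
  have := hW.isProbabilityMeasure
  obtain ⟨V, mV, cV, zV, hWV⟩ := hW.exists_measurable_continuous
  have hV : IsBrownianMotion V P := hW.congr hWV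
  obtain ⟨-, p, hp⟩ := hA
  obtain ⟨-, q, hq⟩ := hB
  rw [avoidableFrom_congr hWV, avoidableFrom_iff hAcl mV cV] at hp
  rw [avoidableFrom_congr hWV, avoidableFrom_iff hBcl mV cV] at hq
  have hcl := hAcl.union hBcl
  obtain ⟨x, hx⟩ := hV.exists_avoidProb_union_ne_zero mV cV hAcl hBcl hp hq
  have key : ∀ p ∉ A ∪ B, AvoidableFrom W P (A ∪ B) p := fun p hp ↦ by
    rw [avoidableFrom_congr hWV, avoidableFrom_iff hcl mV cV]
    exact hV.avoidProb_ne_zero mV cV zV hcl hAB.isPreconnected hx hp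
  obtain ⟨z, hz⟩ := hAB.nonempty
  exact ⟨⟨hAB, z, key z hz⟩, key⟩
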